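/- A $\tau$-expansion $\mathfrak A_\tau=(\mathfrak A,\tau)$ is a Heyting algebra $\mathfrak A$ with a distinguished element $\tau$. A $\sim$-negation on a Heyting algebra is a unary operation $\sim$ such that, for all $x,y$, $$x\to y\le {\sim}y\to{\sim}x,\qquad x\wedge{\sim}x\le{\sim}1,\qquad {\sim}0\le x\vee{\sim}x,\qquad {\sim}0\to{\sim}1\le{\sim}1 .$$ A $\tau\sim$-expansion $(\mathfrak B_\tau,\sim)$ is a $\tau$-expansion $\mathfrak B_\tau$ together with a $\sim$-negation such that ${\sim}1=\tau$. The $\tau$-expansion $\mathfrak A_\tau$ is packed in $\mathfrak B_\tau$, written $\mathfrak A_\tau\vartriangleleft\mathfrak B_\tau$, if $\mathfrak A_\tau$ is, up to isomorphism, a subalgebra of $\mathfrak B_\tau$ (as a Heyting algebra with the constant $\tau$), and $(\mathfrak B_\tau,\sim)$ is generated by the universe of $\mathfrak A$ under the Heyting operations, $\tau$ and $\sim$. The logic $L(\mathfrak A_\tau)$ is the set of all formulas built from countably infinitely many propositional variables and the constant $\tau$ by $\wedge,\vee,\to,\neg$ that take the value $1$ under every valuation in $\mathfrak A_\tau$ (with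 the connective $\tau$ interpreted as the element $\tau$); $L(\mathfrak B_\tau)$ is defined likewise and does not involve $\sim$. An element $a$ of a Heyting algebra is enrichable if there is an element $b$ with $a\le b$, $b\to a=a$, and $b\le x\vee(x\to a)$ for every $x$. **Corollary.** For every $\tau$-expansion $\mathfrak A_\tau$ there is a $\tau\sim$-expansion $(\mathfrak B_\tau,\sim)$ such that $\mathfrak A_\tau\vartriangleleft\mathfrak B_\tau$ and $L(\mathfrak A_\tau)=L(\mathfrak B_\tau)$. In particular, $\tau$ is enrichable in $\mathfrak B_\tau$. -/

import Mathlib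

universe u

namespace TauHeyting

/-- `b` enriches `a` in a Heyting algebra. -/
structure Enriches {A : Type u} [HeytingAlgebra A] (b a : A) : Prop where
  le : a ≤ b
  himp_eq : b ⇨ a = a
  le_sup_himp : ∀ x : A, b ≤ x ⊔ (x ⇨ a)

/-- An element of a Heyting algebra is enrichable if some element enriches it. -/
def IsEnrichable {A : Type u} [HeytingAlgebra A] (a : A) : Prop :=
  ∃ b : A, Enriches b a

/-- A unary operation `t` on a Heyting algebra is a tilde-negation. -/
structure IsTildeNegation {A : Type u} [HeytingAlgebra A] (t : A → A) : Prop where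
  antitone_himp : ∀ x y : A, x ⇨ y ≤ t y ⇨ t x
  inf_le : ∀ x : A, x ⊓ t x ≤ t ⊤
  le_sup : ∀ x : A, t ⊥ ≤ x ⊔ t x
  himp_le : t ⊥ ⇨ t ⊤ ≤ t ⊤

/-- A τ-expansion: a Heyting algebra with a distinguished constant. -/
class TauExpansion (A : Type u) extends HeytingAlgebra A where
  tau : A

/-- A τ∼-expansion: a τ-expansion with a tilde-negation `tilde` such that `tilde ⊤ = tau`. -/
class TauTildeExpansion (A : Type u) extends TauExpansion A where
  tilde : A → A
  isTildeNegation : IsTildeNegation tilde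
  tilde_top : tilde ⊤ = tau

/-- Formulas over countably many variables, with connectives ∧, ∨, →, ¬ and the nullary
connective τ. -/
inductive Formula : Type
  | var : ℕ → Formula
  | and : Formula → Formula → Formula
  | or : Formula → Formula → Formula
  | imp : Formula → Formula → Formula
  | neg : Formula → Formula
  | tau : Formula

/-- A valuation: a homomorphism from the formula algebra to a τ-expansion. -/
structure Valuation (A : Type u) [TauExpansion A] where
  toFun : Formula → A
  map_and : ∀ p q, toFun (Formula.and p q) = toFun p ⊓ toFun q
  map_or : ∀ p q, toFun (Formula.or p q) = toFun p ⊔ toFun q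
  map_imp : ∀ p q, toFun (Formula.imp p q) = toFun p ⇨ toFun q
  map_neg : ∀ p, toFun (Formula.neg p) = (toFun p)ᶜ
  map_tau : toFun Formula.tau = TauExpansion.tau

/-- The logic of a τ-expansion: the formulas that take the value `⊤` under every valuation. -/
def logic (A : Type u) [TauExpansion A] : Set Formula :=
  {p | ∀ v : Valuation A, v.toFun p = ⊤}

/-- `f` is an embedding of τ-expansions. -/
structure IsTauEmbedding {A B : Type u} [TauExpansion A] [TauExpansion B]
    (f : HeytingHom A B) : Prop where
  injective : Function.Injective f
  map_tau : f TauExpansion.tau = TauExpansion.tau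

/-- `S` is the universe of a subalgebra of a τ∼-expansion. -/
structure IsSubuniverse {B : Type u} [TauTildeExpansion B] (S : Set B) : Prop where
  bot_mem : ⊥ ∈ S
  top_mem : ⊤ ∈ S
  inf_mem : ∀ x ∈ S, ∀ y ∈ S, x ⊓ y ∈ S
  sup_mem : ∀ x ∈ S, ∀ y ∈ S, x ⊔ y ∈ S
  himp_mem : ∀ x ∈ S, ∀ y ∈ S, x ⇨ y ∈ S
  compl_mem : ∀ x ∈ S, xᶜ ∈ S
  tau_mem : TauExpansion.tau ∈ S
  tilde_mem : ∀ x ∈ S, TauTildeExpansion.tilde x ∈ S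

/-- A τ∼-expansion is generated by `X` if its only subalgebra containing `X` is the whole
algebra. -/
def IsGeneratedBy (B : Type u) [TauTildeExpansion B] (X : Set B) : Prop :=
  ∀ S : Set B, IsSubuniverse S → X ⊆ S → S = Set.univ

/-- The τ-expansion `A` is packed in the τ-reduct of the τ∼-expansion `B`: up to isomorphism it is
a subalgebra of that reduct, and `A` generates `B` as a τ∼-expansion. -/
def PackedIn (A B : Type u) [TauExpansion A] [TauTildeExpansion B] : Prop :=
  ∃ f : HeytingHom A B, IsTauEmbedding f ∧ IsGeneratedBy B (Set.range f)

end TauHeyting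

/-! An enriching element for τ should be the meet of all `x ⊔ (x ⇨ τ)`, which `A` may lack. Finite
meets `m` of these satisfy `m ⇨ τ = τ` (`finset_inf_sup_himp_himp`), so their germ `b` in the
reduced power of `A` along its finite subsets satisfies `b ⇨ τ = τ` and lies below `a ⊔ (a ⇨ τ)` for
every `a` in `A`. In the subalgebra generated by `A` and `b`, each element agrees below `b` with one
from `A` (`MemAdjoin.exists_inf_eq`), so `b` enriches τ there. Then `∼x = b ⊓ (x ⇨ τ)` is a
tilde-negation with `∼⊥ = b`, whence `A` generates. Reduced powers and subalgebras preserve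
identities and `A` embeds, so the logic is unchanged. -/

namespace TauHeyting

open Filter (Germ atTop eventually_congr eventually_ge_atTop)

section Germ

variable {ι : Type*} {l : Filter ι} {A : Type*} [HeytingAlgebra A]

/-- The reduced power of a Heyting algebra is a Heyting algebra. -/
instance germHeytingAlgebra : HeytingAlgebra (Germ l A) where
  __ := Germ.instLattice (l := l) (β := A)
  __ := Germ.instBoundedOrder (l := l) (β := A)
  himp := Germ.map₂ (· ⇨ ·)
  compl := Germ.map compl
  le_himp_iff x y z := by
    induction x, y, z using Germ.inductionOn₃ with | _ f g h => ?_
    exact eventually_congr (.of_forall fun _ => le_himp_iff)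
  himp_bot x := by
    induction x using Germ.inductionOn with | _ f => ?_
    exact congrArg _ (funext fun i => himp_bot (f i))

/-- The diagonal embedding of a Heyting algebra into its reduced power. -/
def germDiagonal (l : Filter ι) (A : Type*) [HeytingAlgebra A] : HeytingHom A (Germ l A) where
  toFun a := (a : Germ l A)
  map_sup' _ _ := rfl
  map_inf' _ _ := rfl
  map_bot' := rfl
  map_himp' _ _ := rfl

end Germ

section Dense

variable {A : Type*} [HeytingAlgebra A]

theorem sup_himp_himp (x t : A) : x ⊔ (x ⇨ t) ⇨ t = t := by
  refine le_antisymm ?_ le_himp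
  rw [sup_himp_distrib]
  exact himp_inf_le.trans' (by rw [inf_comm])

theorem finset_inf_sup_himp_himp (s : Finset A) (t : A) :
    (s.inf fun x => x ⊔ (x ⇨ t)) ⇨ t = t := by
  classical
  induction s using Finset.induction_on with
  | empty => simp
  | insert x s _ ih => rw [Finset.inf_insert, inf_comm, ← himp_himp, sup_himp_himp, ih]

/-- Below `b`, both `x` and `x ⇨ t` depend only on the trace `x ⊓ b`. -/
theorem sup_himp_inf_congr {x a b t : A} (h : x ⊓ b = a ⊓ b) (ha : b ≤ a ⊔ (a ⇨ t)) :
    b ≤ x ⊔ (x ⇨ t) := by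
  have h1 : a ⊓ b ≤ x := h ▸ inf_le_left
  have h2 : (a ⇨ t) ⊓ b ≤ x ⇨ t := by
    rw [le_himp_iff, inf_assoc, inf_comm b x, h, ← inf_assoc]
    exact inf_le_left.trans himp_inf_le
  calc b = (a ⊔ (a ⇨ t)) ⊓ b := (inf_eq_right.2 ha).symm
    _ = a ⊓ b ⊔ (a ⇨ t) ⊓ b := inf_sup_right _ _ _
    _ ≤ x ⊔ (x ⇨ t) := sup_le_sup h1 h2

end Dense

theorem Enriches.isTildeNegation {A : Type*} [HeytingAlgebra A] {b t : A} (h : Enriches b t) :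
    IsTildeNegation fun x : A => b ⊓ (x ⇨ t) where
  antitone_himp x y := by
    rw [le_himp_iff]
    refine le_inf (inf_le_right.trans inf_le_left) ?_
    exact (inf_le_inf_left _ inf_le_right).trans (himp_triangle x y t)
  inf_le x := by
    rw [top_himp, inf_eq_right.2 h.le]
    exact (inf_le_inf_left x inf_le_right).trans inf_himp_le
  le_sup x := by
    rw [bot_himp, inf_top_eq, sup_inf_left]
    exact le_inf le_sup_right (h.le_sup_himp x)
  himp_le := by
    rw [bot_himp, inf_top_eq, top_himp, inf_eq_right.2 h.le, h.himp_eq]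

section Adjoin

variable {A C : Type*} [HeytingAlgebra A] [HeytingAlgebra C]

/-- Membership in the Heyting subalgebra generated by the range of `f` and the element `b`. -/
inductive MemAdjoin (f : HeytingHom A C) (b : C) : C → Prop
  | base (a : A) : MemAdjoin f b (f a)
  | gen : MemAdjoin f b b
  | inf {x y : C} : MemAdjoin f b x → MemAdjoin f b y → MemAdjoin f b (x ⊓ y)
  | sup {x y : C} : MemAdjoin f b x → MemAdjoin f b y → MemAdjoin f b (x ⊔ y)
  | himp {x y : C} : MemAdjoin f b x → MemAdjoin f b y → MemAdjoin f b (x ⇨ y)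

/-- The Heyting subalgebra generated by the range of `f` and the element `b`. -/
abbrev Adjoin (f : HeytingHom A C) (b : C) : Type _ := {x : C // MemAdjoin f b x}

variable (f : HeytingHom A C) (b : C)

instance : Max (Adjoin f b) := ⟨fun x y => ⟨x.1 ⊔ y.1, x.2.sup y.2⟩⟩
instance : Min (Adjoin f b) := ⟨fun x y => ⟨x.1 ⊓ y.1, x.2.inf y.2⟩⟩
instance : Top (Adjoin f b) := ⟨⟨⊤, map_top f ▸ .base ⊤⟩⟩
instance : Bot (Adjoin f b) := ⟨⟨⊥, map_bot f ▸ .base ⊥⟩⟩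
instance : HImp (Adjoin f b) := ⟨fun x y => ⟨x.1 ⇨ y.1, x.2.himp y.2⟩⟩
instance : Compl (Adjoin f b) :=
  ⟨fun x => ⟨x.1ᶜ, himp_bot x.1 ▸ x.2.himp (map_bot f ▸ .base ⊥)⟩⟩

instance : HeytingAlgebra (Adjoin f b) :=
  Subtype.val_injective.heytingAlgebra Subtype.val Iff.rfl Iff.rfl (fun _ _ => rfl)
    (fun _ _ => rfl) rfl rfl (fun _ => rfl) (fun _ _ => rfl)

/-- The corestriction of `f` to the subalgebra generated by its range and `b`. -/
def adjoinHom : HeytingHom A (Adjoin f b) where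
  toFun a := ⟨f a, .base a⟩
  map_sup' _ _ := Subtype.ext (map_sup f _ _)
  map_inf' _ _ := Subtype.ext (map_inf f _ _)
  map_bot' := Subtype.ext (map_bot f)
  map_himp' _ _ := Subtype.ext (map_himp f _ _)

variable {f b}

/-- Below `b`, every element of the generated subalgebra agrees with an element of the range. -/
theorem MemAdjoin.exists_inf_eq {x : C} (hx : MemAdjoin f b x) : ∃ a : A, x ⊓ b = f a ⊓ b := by
  induction hx with
  | base a => exact ⟨a, rfl⟩
  | gen => exact ⟨⊤, by simp⟩
  | @inf x y _ _ hx hy =>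
    obtain ⟨a, ha⟩ := hx
    obtain ⟨c, hc⟩ := hy
    exact ⟨a ⊓ c, by rw [map_inf, inf_inf_distrib_right, ha, hc, ← inf_inf_distrib_right]⟩
  | @sup x y _ _ hx hy =>
    obtain ⟨a, ha⟩ := hx
    obtain ⟨c, hc⟩ := hy
    exact ⟨a ⊔ c, by rw [map_sup, inf_sup_right, ha, hc, ← inf_sup_right]⟩
  | @himp x y _ _ hx hy =>
    obtain ⟨a, ha⟩ := hx
    obtain ⟨c, hc⟩ := hy
    -- Having equal meets with `b` is a congruence for implication too.
    have key : ∀ u v : C, (u ⇨ v) ⊓ b = (u ⊓ b ⇨ v ⊓ b) ⊓ b := fun u v => by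
      apply le_antisymm
      · refine le_inf (le_himp_iff.2 (le_inf ?_ (inf_le_left.trans inf_le_right))) inf_le_right
        exact (inf_le_inf inf_le_left inf_le_left).trans himp_inf_le
      · refine le_inf (le_himp_iff.2 ?_) inf_le_right
        rw [inf_assoc, inf_comm b u]
        exact himp_inf_le.trans inf_le_left
    exact ⟨a ⇨ c, by rw [map_himp, key, ha, hc, ← key]⟩

/-- To enrich an element of the range in the generated subalgebra, it is enough to test the
defining inequality on the range. -/
theorem enriches_adjoin {t : A} (hle : f t ≤ b) (hb : b ⇨ f t = f t)
    (h : ∀ a : A, b ≤ f a ⊔ (f a ⇨ f t)) :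
    Enriches (⟨b, .gen⟩ : Adjoin f b) ⟨f t, .base t⟩ where
  le := hle
  himp_eq := Subtype.ext hb
  le_sup_himp x := by
    obtain ⟨a, ha⟩ := x.2.exists_inf_eq
    exact sup_himp_inf_congr (x := x.1) ha (h a)

end Adjoin

section Expansion

variable {A C : Type u} [TauExpansion A] [HeytingAlgebra C] {f : HeytingHom A C} {b : C}

/-- The τ∼-expansion on the subalgebra generated by the range of `f` and an element `b` that
enriches the image of `tau`. -/
abbrev adjoinExpansion
    (h : Enriches (⟨b, .gen⟩ : Adjoin f b) ⟨f TauExpansion.tau, .base TauExpansion.tau⟩) :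
    TauTildeExpansion (Adjoin f b) where
  tau := ⟨f TauExpansion.tau, .base TauExpansion.tau⟩
  tilde x := ⟨b, .gen⟩ ⊓ (x ⇨ ⟨f TauExpansion.tau, .base TauExpansion.tau⟩)
  isTildeNegation := h.isTildeNegation
  tilde_top := by rw [top_himp, inf_eq_right.2 h.le]

theorem packedIn_adjoin (hf : Function.Injective f)
    (h : Enriches (⟨b, .gen⟩ : Adjoin f b) ⟨f TauExpansion.tau, .base TauExpansion.tau⟩) :
    letI := adjoinExpansion h
    PackedIn A (Adjoin f b) := by
  let _ := adjoinExpansion h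
  refine ⟨adjoinHom f b, ⟨fun x y hxy => hf (congrArg Subtype.val hxy), rfl⟩, fun S hS hA => ?_⟩
  -- The generator is recovered as `∼⊥ = b ⊓ (⊥ ⇨ τ) = b`.
  have hgen : (⟨b, .gen⟩ : Adjoin f b) ∈ S := by
    have := hS.tilde_mem ⊥ hS.bot_mem
    rwa [show TauTildeExpansion.tilde (⊥ : Adjoin f b) = ⟨b, .gen⟩ from
      (congrArg _ (bot_himp _)).trans (inf_top_eq _)] at this
  refine Set.eq_univ_of_forall fun ⟨x, hx⟩ => ?_
  induction hx with
  | base a => exact hA ⟨a, rfl⟩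
  | gen => exact hgen
  | inf hx hy ihx ihy => exact hS.inf_mem _ ihx _ ihy
  | sup hx hy ihx ihy => exact hS.sup_mem _ ihx _ ihy
  | himp hx hy ihx ihy => exact hS.himp_mem _ ihx _ ihy

end Expansion

section Logic

/-- The value of a formula under an assignment of its variables. -/
def evalFormula {A : Type u} [TauExpansion A] (g : ℕ → A) : Formula → A
  | .var n => g n
  | .and p q => evalFormula g p ⊓ evalFormula g q
  | .or p q => evalFormula g p ⊔ evalFormula g q
  | .imp p q => evalFormula g p ⇨ evalFormula g q
  | .neg p => (evalFormula g p)ᶜ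
  | .tau => TauExpansion.tau

/-- The valuation that extends an assignment of the variables. -/
def valuationOf {A : Type u} [TauExpansion A] (g : ℕ → A) : Valuation A where
  toFun := evalFormula g
  map_and _ _ := rfl
  map_or _ _ := rfl
  map_imp _ _ := rfl
  map_neg _ := rfl
  map_tau := rfl

/-- The composite of a valuation with a homomorphism of τ-expansions. -/
def Valuation.comp {A B : Type u} [TauExpansion A] [TauExpansion B] (v : Valuation A)
    (f : HeytingHom A B) (hf : f TauExpansion.tau = TauExpansion.tau) : Valuation B where
  toFun p := f (v.toFun p)
  map_and p q := by rw [v.map_and, map_inf]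
  map_or p q := by rw [v.map_or, map_sup]
  map_imp p q := by rw [v.map_imp, map_himp]
  map_neg p := by rw [v.map_neg, map_compl]
  map_tau := by rw [v.map_tau, hf]

theorem IsTauEmbedding.logic_subset {A B : Type u} [TauExpansion A] [TauExpansion B]
    {f : HeytingHom A B} (hf : IsTauEmbedding f) : logic B ⊆ logic A := fun _ hp v =>
  hf.injective ((hp (v.comp f hf.map_tau)).trans (map_top f).symm)

/-- The reduced power of a τ-expansion. -/
instance germTauExpansion {ι : Type u} {l : Filter ι} {A : Type u} [TauExpansion A] :
    TauExpansion (Germ l A) where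
  tau := ((TauExpansion.tau : A) : Germ l A)

theorem logic_subset_logic_germ {ι : Type u} (l : Filter ι) (A : Type u) [TauExpansion A] :
    logic A ⊆ logic (Germ l A) := by
  intro p hp v
  -- With representatives fixed for the variables, every formula is evaluated coordinatewise.
  choose g hg using fun n => Quotient.exists_rep (v.toFun (.var n))
  have key : ∀ q : Formula,
      v.toFun q = ((fun i => evalFormula (fun n => g n i) q : ι → A) : Germ l A) := by
    intro q
    induction q with
    | var n => exact (hg n).symm
    | and p q hp hq => rw [v.map_and, hp, hq]; rfl
    | or p q hp hq => rw [v.map_or, hp, hq]; rfl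
    | imp p q hp hq => rw [v.map_imp, hp, hq]; rfl
    | neg p hp => rw [v.map_neg, hp]; rfl
    | tau => exact v.map_tau
  rw [key]
  exact congrArg _ (funext fun i => hp (valuationOf fun n => g n i))

end Logic

/-- The germ of the finite meets of the elements `x ⊔ (x ⇨ t)`. -/
def enrichingGerm {A : Type u} [HeytingAlgebra A] (t : A) : Germ (atTop : Filter (Finset A)) A :=
  ((fun s => s.inf fun x => x ⊔ (x ⇨ t) : Finset A → A) : Germ atTop A)

theorem enriches_enrichingGerm {A : Type u} [HeytingAlgebra A] (t : A) :
    Enriches (⟨enrichingGerm t, .gen⟩ : Adjoin (germDiagonal atTop A) (enrichingGerm t))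
      ⟨germDiagonal atTop A t, .base t⟩ := by
  refine enriches_adjoin ?_ ?_ fun a => ?_
  · exact Germ.coe_le.2 (.of_forall fun s => Finset.le_inf fun x _ => le_sup_of_le_right le_himp)
  · exact congrArg _ (funext fun s => finset_inf_sup_himp_himp s t)
  -- As soon as `a ∈ s`, the term `a ⊔ (a ⇨ t)` is one of those in the meet.
  · refine Germ.coe_le.2 ((eventually_ge_atTop {a}).mono fun s hs => ?_)
    exact Finset.inf_le (Finset.singleton_subset_iff.1 hs)

end TauHeyting

open TauHeyting in
theorem mainTheorem4 (A : Type u) [TauHeyting.TauExpansion A] :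
    ∃ (B : Type u) (_ : TauHeyting.TauTildeExpansion B),
      TauHeyting.PackedIn A B ∧
      TauHeyting.logic A = TauHeyting.logic B ∧
      TauHeyting.IsEnrichable (TauHeyting.TauExpansion.tau : B) := by
  have h := enriches_enrichingGerm (TauExpansion.tau : A)
  let _ := adjoinExpansion h
  have hf : Function.Injective (germDiagonal (Filter.atTop : Filter.{u} (Finset A)) A) :=
    fun x y hxy => Filter.Germ.const_inj.1 hxy
  have hp := packedIn_adjoin hf h
  refine ⟨_, adjoinExpansion h, hp, ?_, _, h⟩
  obtain ⟨g, hg, -⟩ := hp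
  refine subset_antisymm (fun p hp v => ?_) hg.logic_subset
  -- The inclusion carries a refutation in the subalgebra to one in the reduced power.
  let i : HeytingHom (Adjoin (germDiagonal Filter.atTop A) (enrichingGerm (TauExpansion.tau : A)))
      (Filter.Germ Filter.atTop A) := ⟨⟨⟨Subtype.val, fun _ _ => rfl⟩, fun _ _ => rfl⟩, rfl, fun _ _ => rfl⟩
  exact Subtype.ext (logic_subset_logic_germ _ A hp (v.comp i rfl))
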